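/- **Setting.** There are $T$ queries and $M$ models. At query $t$ model $m$ yields a Bernoulli reward with mean $\mu_{t,m}\in[0,1]$, independently over queries; it has cost $c_m>0$, throughput limit $\alpha_m$, and is available from query $t_m$ on; $\mathcal M_t=\{m: t_m\le t\}$. The horizon is divided into $K$ equal stages ($K\mid T$) starting at $\tau_k=(k-1)T/K+1$. An online policy $\mathcal A$ with concurrency cap $M_{\max}$ chooses (possibly at random, from the past record of deployments, selected models and rewards) a nonempty deployed set of at most $M_{\max}$ models at each $\tau_k$, keeps it during the stage, and at each query $t$ chooses (possibly at random) a model $m_t$ from the deployed set. For a budget $b$ and a set $\mathcal S$ of models let $$V_t(b,\mathcal S)=\max\Big\{\sum_{m\in\mathcal S}\mu_{t,m}p(m)\;:\;p\in\Delta(\mathcal S),\ \sum_{m}c_m p(m)\le b,\ p(m)\le\alpha_m,\ |\mathrm{supp}(p)|\le M_{\max}\Big\}$$ (and $0$ if no $p$ is feasible). The regret against the time-varying oracle is $$\mathrm{Regret}(\mathcal A)=\sum_{t=1}^T V_t(b,\mathcal M_t)-\mathbb E\Big[\sum_{t=1}^T\mu_{t,m_t}\Big],$$ and the regret against the stage-start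 benchmark is $$\mathrm{Regret}^{*}(\mathcal A)=\sum_{k=1}^K \tfrac TK\,V_{\tau_k}(b,\mathcal M_{\tau_k})-\mathbb E\Big[\sum_{t=1}^T\mu_{t,m_t}\Big].$$ **Theorem.** There are universal constants $c,c_1,c_2,C_0>0$ such that the following holds for all $M\ge 2$, all $T\ge C_0M$ and all $K\ge1$ with $K\mid T$. There are a batch length $\Delta\in\{1,\dots,T\}$ with $c_1M^{1/3}T^{2/3}\le\Delta\le c_2M^{1/3}T^{2/3}$ and a gap $\varepsilon$ with $c_1(M/T)^{1/3}\le\varepsilon\le c_2(M/T)^{1/3}$ and $\lceil T/\Delta\rceil\,\varepsilon\le\frac14$ such that, for every concurrency cap $M_{\max}\ge1$, every budget $b\ge1$ and every online policy $\mathcal A$, there is a sequence $s_1,s_2,\dots\in\{1,\dots,M\}$ for which the following piecewise-stationary instance is hard. The horizon is cut into consecutive batches of length $\Delta$ (the last one possibly shorter); in batch $j$ the reward of model $s_j$ is Bernoulli with mean $\frac12+j\varepsilon$ and the reward of every other model is Bernoulli with mean $\frac12+(j-1)\varepsilon$; all $M$ models are available throughout, with $c_m=1$ and $\alpha_m=1$.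 On this instance $$\mathrm{Regret}(\mathcal A)\ \ge\ c\,M^{1/3}T^{2/3},$$ and, if moreover $T\le 2C_0MK^3$, then also $\mathrm{Regret}^{*}(\mathcal A)\ge c\,M^{1/3}T^{2/3}$. In particular, for any fixed number $M\ge2$ of models, any $K$ and any $M_{\max}$, the regret of every online policy against the time-varying oracle is $\Omega(T^{2/3})$ on some such instance. -/

import Mathlib

/-!
Online deployment and routing over `M` models and `T` rounds (queries). Rounds, stages and batches
are numbered from `0`, so round `t` below is the query number `t + 1`.
-/

namespace LLMRouting

/-- A stochastic routing instance with `M` models and horizon `T`, with Bernoulli rewards whose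
means may change from round to round, and with deterministic costs. -/
structure RoutingInstance (T M : ℕ) where
  /-- `mean t m` is the mean of the Bernoulli reward of model `m` at round `t`. -/
  mean : ℕ → Fin M → ℝ
  mean_mem : ∀ t < T, ∀ m, mean t m ∈ Set.Icc (0 : ℝ) 1
  /-- operational cost of one invocation of a model -/
  cost : Fin M → ℝ
  cost_pos : ∀ m, 0 < cost m
  /-- throughput limit of a model -/
  throughput : Fin M → ℝ
  /-- first round at which a model is available -/
  avail : Fin M → ℕ

/-- The pool of the models that are available at round `t`. -/
def RoutingInstance.pool {T M : ℕ} (I : RoutingInstance T M) (t : ℕ) : Finset (Fin M) :=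
  Finset.univ.filter fun m => I.avail m ≤ t

/-- The optimal performance rate `V(b, S)` for the reward means of round `t`: the largest expected
reward of one query over the distributions on `S` that respect the budget `b`, the throughput limits
and the concurrency cap `Mmax`. It is `0` if there is no such distribution. -/
noncomputable def RoutingInstance.rate {T M : ℕ} (I : RoutingInstance T M) (t : ℕ) (b : ℝ)
    (Mmax : ℕ) (S : Finset (Fin M)) : ℝ :=
  sSup {v : ℝ | ∃ p : Fin M → ℝ, (∀ m, 0 ≤ p m) ∧ (∀ m, m ∉ S → p m = 0) ∧ ∑ m, p m = 1 ∧
    ∑ m, I.cost m * p m ≤ b ∧ (∀ m ∈ S, p m ≤ I.throughput m) ∧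
    (Finset.univ.filter fun m => p m ≠ 0).card ≤ Mmax ∧ v = ∑ m, I.mean t m * p m}

/-- The record of one round: the deployed set, the selected model and its Bernoulli reward. -/
abbrev Round (M : ℕ) : Type := Finset (Fin M) × Fin M × Bool

/-- A randomized online policy with concurrency cap `Mmax`. At the first round of a stage it draws
the set to deploy from `deploy t h`, and at every round it draws the model that serves the query
from `route t h D`, where `h` is the record of the `t` rounds so far and `D` the deployed set.
(Availability, throughput and budget are not imposed here: a lower bound for all such policies holds
in particular for those that respect them.) -/
structure Policy (M Mmax : ℕ) where
  deploy : (t : ℕ) → (Fin t → Round M) → PMF (Finset (Fin M))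
  route : (t : ℕ) → (Fin t → Round M) → Finset (Fin M) → PMF (Fin M)
  deploy_nonempty : ∀ t h, ∀ D ∈ (deploy t h).support, D.Nonempty
  deploy_card : ∀ t h, ∀ D ∈ (deploy t h).support, D.card ≤ Mmax
  route_mem : ∀ t h D, D.Nonempty → ∀ m ∈ (route t h D).support, m ∈ D

/-- The distribution of the set deployed at round `t` after the record `h`, for stages of length
`L`: a fresh draw if a stage starts at round `t`, otherwise the set of the previous round. -/
noncomputable def Policy.deployed {M Mmax : ℕ} (A : Policy M Mmax) (L t : ℕ)
    (h : Fin t → Round M) : PMF (Finset (Fin M)) :=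
  if hL : L ∣ t then A.deploy t h
  else PMF.pure (h ⟨t - 1, Nat.sub_lt (Nat.pos_of_ne_zero fun h0 => hL (h0 ▸ dvd_zero L))
    Nat.one_pos⟩).1

/-- The probability that the first `t` rounds of policy `A` on instance `I`, with stages of length
`L`, have the record `h`. -/
noncomputable def Policy.pathProb {T M Mmax : ℕ} (A : Policy M Mmax) (I : RoutingInstance T M)
    (L : ℕ) : (t : ℕ) → (Fin t → Round M) → ℝ
  | 0, _ => 1
  | t + 1, h =>
    let past : Fin t → Round M := fun i => h i.castSucc
    let D : Finset (Fin M) := (h (Fin.last t)).1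
    let m : Fin M := (h (Fin.last t)).2.1
    A.pathProb I L t past * (A.deployed L t past D).toReal * (A.route t past D m).toReal *
      (if (h (Fin.last t)).2.2 then I.mean t m else 1 - I.mean t m)

/-- The expected cumulative performance of policy `A`, the expectation of the sum over the rounds of
the mean reward of the selected model, when the horizon `T` is divided into `K` equal stages. -/
noncomputable def Policy.performance {T M Mmax : ℕ} (A : Policy M Mmax) (I : RoutingInstance T M)
    (K : ℕ) : ℝ :=
  ∑ h : Fin T → Round M, A.pathProb I (T / K) T h * ∑ t : Fin T, I.mean t (h t).2.1

/-- Regret against the time-varying oracle that attains at each round the optimal rate of the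
current pool for the current means. -/
noncomputable def Policy.regret {T M Mmax : ℕ} (A : Policy M Mmax) (I : RoutingInstance T M)
    (K : ℕ) (b : ℝ) : ℝ :=
  (∑ t ∈ Finset.range T, I.rate t b Mmax (I.pool t)) - A.performance I K

/-- Regret against the benchmark `OPT^*` that evaluates the optimal rate at the stage starts only
and weighs it with the stage length `T / K`. -/
noncomputable def Policy.stageRegret {T M Mmax : ℕ} (A : Policy M Mmax) (I : RoutingInstance T M)
    (K : ℕ) (b : ℝ) : ℝ :=
  (∑ k ∈ Finset.range K,
    ((T / K : ℕ) : ℝ) * I.rate (k * (T / K)) b Mmax (I.pool (k * (T / K)))) - A.performance I K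

/-- The piecewise-stationary drifting instance: the rounds are cut into batches of length `Δ` (the
last one possibly shorter). In batch `j = 0, 1, …` the model `s j` has mean `1/2 + (j + 1) ε` and all
other models have mean `1/2 + j ε`. All models are always available, have unit cost and no
effective throughput limit. -/
structure RoutingInstance.IsDriftingBatch {T M : ℕ} (I : RoutingInstance T M) (Δ : ℕ) (ε : ℝ)
    (s : ℕ → Fin M) : Prop where
  strong : ∀ t < T, I.mean t (s (t / Δ)) = 1 / 2 + (((t / Δ : ℕ) : ℝ) + 1) * ε
  weak : ∀ t < T, ∀ m, m ≠ s (t / Δ) → I.mean t m = 1 / 2 + ((t / Δ : ℕ) : ℝ) * ε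
  cost_eq : ∀ m, I.cost m = 1
  throughput_eq : ∀ m, I.throughput m = 1
  avail_eq : ∀ m, I.avail m = 0

end LLMRouting

namespace LLMRouting

open Finset

section Law

variable {T M Mmax : ℕ} (A : Policy M Mmax) (I : RoutingInstance T M) (L : ℕ)

lemma pmf_sum_toReal {α : Type*} [Fintype α] (p : PMF α) : ∑ x, (p x).toReal = 1 := by
  rw [← ENNReal.toReal_sum fun x _ => p.apply_ne_top x, ← tsum_fintype (L := .unconditional _),
    p.tsum_coe, ENNReal.toReal_one]

/-- The expectation of a function of the record of the first `t` rounds. -/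
noncomputable def Policy.pathExp (t : ℕ) (f : (Fin t → Round M) → ℝ) : ℝ :=
  ∑ h, A.pathProb I L t h * f h

/-- The probability that model `m` serves the query of round `t`. -/
noncomputable def Policy.selectProb (t : ℕ) (m : Fin M) : ℝ :=
  A.pathExp I L (t + 1) fun h => if (h (Fin.last t)).2.1 = m then 1 else 0

lemma pathExp_succ (t : ℕ) (f : (Fin (t + 1) → Round M) → ℝ) :
    A.pathExp I L (t + 1) f = A.pathExp I L t fun h =>
      ∑ D, (A.deployed L t h D).toReal * ∑ m, (A.route t h D m).toReal *
        (I.mean t m * f (Fin.snoc (α := fun _ => Round M) h (D, m, true)) +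
          (1 - I.mean t m) * f (Fin.snoc (α := fun _ => Round M) h (D, m, false))) := by
  unfold Policy.pathExp
  rw [← (Fin.snocEquiv fun _ => Round M).sum_comp, Fintype.sum_prod_type, sum_comm]
  refine sum_congr rfl fun h _ => ?_
  rw [Fintype.sum_prod_type, mul_sum]
  refine sum_congr rfl fun D _ => ?_
  rw [Fintype.sum_prod_type, mul_sum, mul_sum]
  refine sum_congr rfl fun m _ => ?_
  have hsnoc : ∀ x : Round M, Fin.snocEquiv (fun _ => Round M) (x, h) =
      Fin.snoc (α := fun _ => Round M) h x := fun _ => rfl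
  simp only [Fintype.sum_bool, hsnoc, Policy.pathProb, Fin.snoc_castSucc,
    Fin.snoc_last, if_true, Bool.false_eq_true, if_false]
  ring

lemma pathExp_init (t : ℕ) (f : (Fin t → Round M) → ℝ) :
    A.pathExp I L (t + 1) (fun h => f fun i => h i.castSucc) = A.pathExp I L t f := by
  rw [pathExp_succ]
  congr 1
  funext h
  simp only [Fin.snoc_castSucc, ← add_mul, add_sub_cancel, one_mul]
  simp only [← sum_mul, pmf_sum_toReal, one_mul]

lemma pathExp_apply (f : Round M → ℝ) (n : ℕ) (i : Fin n) :
    A.pathExp I L n (fun h => f (h i)) =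
      A.pathExp I L (i + 1) fun h => f (h (Fin.last i)) := by
  induction n with
  | zero => exact i.elim0
  | succ n ih =>
    refine Fin.lastCases ?_ (fun j => ?_) i
    · rfl
    · rw [pathExp_init A I L n fun h => f (h j)]
      exact ih j

lemma pathExp_one (t : ℕ) : A.pathExp I L t (fun _ => 1) = 1 := by
  induction t with
  | zero => simp [Policy.pathExp, Policy.pathProb]
  | succ n ih => exact (pathExp_init A I L n fun _ => 1).trans ih

lemma pathExp_sum {ι : Type*} (S : Finset ι) (t : ℕ) (f : ι → (Fin t → Round M) → ℝ) :
    A.pathExp I L t (fun h => ∑ i ∈ S, f i h) = ∑ i ∈ S, A.pathExp I L t (f i) := by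
  simp only [Policy.pathExp, mul_sum]
  exact sum_comm

lemma pathExp_add (t : ℕ) (f g : (Fin t → Round M) → ℝ) :
    A.pathExp I L t (fun h => f h + g h) = A.pathExp I L t f + A.pathExp I L t g := by
  simp only [Policy.pathExp, mul_add, sum_add_distrib]

lemma pathExp_const_mul (t : ℕ) (c : ℝ) (f : (Fin t → Round M) → ℝ) :
    A.pathExp I L t (fun h => c * f h) = c * A.pathExp I L t f := by
  simp only [Policy.pathExp, mul_sum]
  exact sum_congr rfl fun _ _ => by ring

lemma pathProb_nonneg (t : ℕ) (ht : t ≤ T) (h : Fin t → Round M) : 0 ≤ A.pathProb I L t h := by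
  induction t with
  | zero => simp [Policy.pathProb]
  | succ t ih =>
    have hm := I.mean_mem t (by omega) (h (Fin.last t)).2.1
    simp only [Policy.pathProb]
    refine mul_nonneg (mul_nonneg (mul_nonneg (ih (by omega) _) ENNReal.toReal_nonneg)
      ENNReal.toReal_nonneg) ?_
    split_ifs
    · exact hm.1
    · linarith [hm.2]

lemma pathExp_mono {t : ℕ} (ht : t ≤ T) {f g : (Fin t → Round M) → ℝ} (hfg : ∀ h, f h ≤ g h) :
    A.pathExp I L t f ≤ A.pathExp I L t g :=
  sum_le_sum fun h _ => mul_le_mul_of_nonneg_left (hfg h) (pathProb_nonneg A I L t ht h)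

lemma selectProb_nonneg {t : ℕ} (ht : t < T) (m : Fin M) : 0 ≤ A.selectProb I L t m :=
  sum_nonneg fun h _ => mul_nonneg (pathProb_nonneg A I L _ ht h) (by positivity)

/-- The expectation of a function of the model selected at a round. -/
lemma pathExp_model (n : ℕ) (i : Fin n) (g : Fin M → ℝ) :
    A.pathExp I L n (fun h => g (h i).2.1) = ∑ m, A.selectProb I L i m * g m := by
  rw [pathExp_apply A I L (fun x => g x.2.1) n i]
  have : (fun h : Fin ((i : ℕ) + 1) → Round M => g (h (Fin.last i)).2.1) =
      fun h => ∑ m, g m * (if (h (Fin.last i)).2.1 = m then 1 else 0) := by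
    funext h; simp
  rw [this, pathExp_sum]
  refine sum_congr rfl fun m _ => ?_
  rw [pathExp_const_mul, mul_comm]
  rfl

/-- The expectation of a function of the model selected at a round and of its reward. -/
lemma pathExp_model_reward (n : ℕ) (i : Fin n) (g : Fin M → Bool → ℝ) :
    A.pathExp I L n (fun h => g (h i).2.1 (h i).2.2) =
      ∑ m, A.selectProb I L i m * (I.mean i m * g m true + (1 - I.mean i m) * g m false) := by
  rw [← pathExp_model A I L n i fun m => I.mean i m * g m true + (1 - I.mean i m) * g m false,
    pathExp_apply A I L (fun x => g x.2.1 x.2.2) n i,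
    pathExp_apply A I L
      (fun x => I.mean i x.2.1 * g x.2.1 true + (1 - I.mean i x.2.1) * g x.2.1 false) n i,
    pathExp_succ, pathExp_succ]
  simp only [Fin.snoc_last, ← add_mul, add_sub_cancel, one_mul]

lemma sum_selectProb (t : ℕ) : ∑ m, A.selectProb I L t m = 1 := by
  have := pathExp_model A I L (t + 1) (Fin.last t) fun _ => 1
  rw [pathExp_one] at this
  simpa using this.symm

lemma performance_eq (K : ℕ) :
    A.performance I K =
      ∑ t ∈ range T, ∑ m, A.selectProb I (T / K) t m * I.mean t m := by
  have : A.performance I K = A.pathExp I (T / K) T fun h => ∑ t : Fin T, I.mean t (h t).2.1 := rfl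
  rw [this, pathExp_sum, ← Fin.sum_univ_eq_sum_range
    (fun t => ∑ m, A.selectProb I (T / K) t m * I.mean t m) T]
  exact sum_congr rfl fun t _ => pathExp_model A I (T / K) T t (I.mean t)

lemma pathProb_congr {I J : RoutingInstance T M} (t : ℕ) (hIJ : ∀ i < t, I.mean i = J.mean i)
    (h : Fin t → Round M) : A.pathProb I L t h = A.pathProb J L t h := by
  induction t with
  | zero => rfl
  | succ t ih =>
    simp only [Policy.pathProb]
    rw [ih (fun i hi => hIJ i (by omega)), hIJ t (by omega)]

lemma selectProb_congr {I J : RoutingInstance T M} (t : ℕ)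
    (hIJ : ∀ i ≤ t, I.mean i = J.mean i) (m : Fin M) :
    A.selectProb I L t m = A.selectProb J L t m :=
  sum_congr rfl fun h _ => by
    rw [pathProb_congr A L (t + 1) (fun i hi => hIJ i (by omega)) h]

end Law

section ChangeOfMeasure

variable {T M Mmax : ℕ} (A : Policy M Mmax) (L : ℕ)

/-- The likelihood ratio of a reward with mean `p` against a reward with mean `q`. -/
noncomputable def bernoulliRatio (q p : ℝ) (r : Bool) : ℝ :=
  if r then p / q else (1 - p) / (1 - q)

/-- The likelihood ratio contributed by one round, if only the mean of model `a` in the rounds of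
`B` is changed, from `q` to `p`. -/
noncomputable def roundRatio (B : Finset ℕ) (a : Fin M) (q p : ℝ) (t : ℕ) (m : Fin M) (r : Bool) :
    ℝ :=
  if t ∈ B ∧ m = a then bernoulliRatio q p r else 1

lemma bernoulliRatio_pos {q p : ℝ} (hq0 : 0 < q) (hq1 : q < 1) (hp0 : 0 < p) (hp1 : p < 1)
    (r : Bool) : 0 < bernoulliRatio q p r := by
  unfold bernoulliRatio
  split_ifs
  · positivity
  · exact div_pos (by linarith) (by linarith)

lemma roundRatio_pos (B : Finset ℕ) (a : Fin M) {q p : ℝ} (hq0 : 0 < q) (hq1 : q < 1)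
    (hp0 : 0 < p) (hp1 : p < 1) (t : ℕ) (m : Fin M) (r : Bool) :
    0 < roundRatio B a q p t m r := by
  unfold roundRatio
  split_ifs
  · exact bernoulliRatio_pos hq0 hq1 hp0 hp1 r
  · exact one_pos

/-- The Kullback-Leibler divergence of two Bernoulli laws is at most the chi-square divergence. -/
lemma bernoulli_kl_le {q p : ℝ} (hq0 : 0 < q) (hq1 : q < 1) (hp0 : 0 < p) (hp1 : p < 1) :
    -(q * Real.log (bernoulliRatio q p true) + (1 - q) * Real.log (bernoulliRatio q p false)) ≤
      (p - q) ^ 2 / (p * (1 - p)) := by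
  have h1 := Real.one_sub_inv_le_log_of_pos (bernoulliRatio_pos hq0 hq1 hp0 hp1 true)
  have h2 := Real.one_sub_inv_le_log_of_pos (bernoulliRatio_pos hq0 hq1 hp0 hp1 false)
  have h3 := mul_le_mul_of_nonneg_left h1 hq0.le
  have h4 := mul_le_mul_of_nonneg_left h2 (sub_nonneg.2 hq1.le)
  have h5 : (p - q) ^ 2 / (p * (1 - p)) = -(q * (1 - (bernoulliRatio q p true)⁻¹) +
      (1 - q) * (1 - (bernoulliRatio q p false)⁻¹)) := by
    have : 1 - p ≠ 0 := by linarith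
    have : 1 - q ≠ 0 := by linarith
    simp only [bernoulliRatio, if_true, Bool.false_eq_true, if_false, inv_div]
    field_simp
    ring
  linarith

lemma pathProb_eq_mul_prod {I J : RoutingInstance T M} {B : Finset ℕ} {a : Fin M} {q p : ℝ}
    (hq0 : 0 < q) (hq1 : q < 1)
    (hI : ∀ t ∈ B, I.mean t a = q) (hJ : ∀ t ∈ B, J.mean t a = p)
    (hIJ : ∀ t < T, ∀ m, ¬(t ∈ B ∧ m = a) → J.mean t m = I.mean t m) (t : ℕ) (ht : t ≤ T)
    (h : Fin t → Round M) :
    A.pathProb J L t h = A.pathProb I L t h *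
      ∏ i : Fin t, roundRatio B a q p i (h i).2.1 (h i).2.2 := by
  induction t with
  | zero => simp [Policy.pathProb]
  | succ t ih =>
    rw [Fin.prod_univ_castSucc]
    simp only [Policy.pathProb]
    rw [ih (by omega)]
    have key : (if (h (Fin.last t)).2.2 then J.mean t (h (Fin.last t)).2.1
          else 1 - J.mean t (h (Fin.last t)).2.1) =
        (if (h (Fin.last t)).2.2 then I.mean t (h (Fin.last t)).2.1
          else 1 - I.mean t (h (Fin.last t)).2.1) *
        roundRatio B a q p t (h (Fin.last t)).2.1 (h (Fin.last t)).2.2 := by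
      generalize (h (Fin.last t)).2.1 = m
      generalize (h (Fin.last t)).2.2 = r
      have : 1 - q ≠ 0 := by linarith
      by_cases hm : t ∈ B ∧ m = a
      · obtain ⟨htB, rfl⟩ := hm
        rw [hI t htB, hJ t htB]
        cases r <;> simp [roundRatio, bernoulliRatio, htB] <;> field_simp
      · rw [hIJ t (by omega) m hm]
        simp [roundRatio, hm]
    rw [key]
    simp only [Fin.val_castSucc, Fin.val_last]
    ring

lemma abs_sub_one_le_of_pos {w : ℝ} (hw : 0 < w) :
    |w - 1| ≤ 8 * (-Real.log w) + (8 + 1 / 16) * w + -(8 - 1 / 16) := by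
  obtain ⟨u, hu, rfl⟩ : ∃ u : ℝ, 0 < u ∧ w = u ^ 2 :=
    ⟨√w, Real.sqrt_pos.2 hw, (Real.sq_sqrt hw.le).symm⟩
  have h := Real.log_le_sub_one_of_pos hu
  rw [Real.log_pow, abs_le]
  push_cast
  constructor <;> nlinarith [sq_nonneg (16 * (u - 1) - (u + 1)), sq_nonneg (16 * (u - 1) + (u + 1)),
    sq_nonneg (u - 1)]

/-- If the mean of model `a` is raised from `q` to `p` in the rounds of `B`, then the expected
number of these rounds in which `a` is selected grows by little. -/
lemma sum_selectProb_le {I J : RoutingInstance T M} {B : Finset ℕ} {a : Fin M} {q p : ℝ}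
    (hB : B ⊆ range T) (hq0 : 0 < q) (hq1 : q < 1) (hp0 : 0 < p) (hp1 : p < 1)
    (hI : ∀ t ∈ B, I.mean t a = q) (hJ : ∀ t ∈ B, J.mean t a = p)
    (hIJ : ∀ t < T, ∀ m, ¬(t ∈ B ∧ m = a) → J.mean t m = I.mean t m) :
    ∑ t ∈ B, A.selectProb J L t a ≤ ∑ t ∈ B, A.selectProb I L t a +
      B.card * (8 * ((p - q) ^ 2 / (p * (1 - p)) * ∑ t ∈ B, A.selectProb I L t a) + 1 / 8) := by
  set n := ∑ t ∈ B, A.selectProb I L t a with hn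
  set w : (Fin T → Round M) → ℝ := fun h =>
    ∏ i : Fin T, roundRatio B a q p i (h i).2.1 (h i).2.2 with hw
  have hrpos := roundRatio_pos B a hq0 hq1 hp0 hp1
  have hwpos : ∀ h, 0 < w h := fun h => prod_pos fun i _ => hrpos _ _ _
  have hchange : ∀ f, A.pathExp J L T f = A.pathExp I L T fun h => w h * f h := fun f =>
    sum_congr rfl fun h _ => by
      rw [pathProb_eq_mul_prod A L hq0 hq1 hI hJ hIJ T le_rfl h, mul_assoc]
  have hBsum : ∀ f : ℕ → ℝ, ∑ t ∈ B, f t = ∑ i : Fin T, if (i : ℕ) ∈ B then f i else 0 := by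
    intro f
    rw [Fin.sum_univ_eq_sum_range (fun i => if i ∈ B then f i else 0) T, ← sum_filter]
    congr 1
    ext t
    simpa using fun ht => mem_range.1 (hB ht)
  set N : (Fin T → Round M) → ℝ := fun h =>
    ∑ i : Fin T, if (i : ℕ) ∈ B then (if (h i).2.1 = a then 1 else 0) else 0 with hN
  have hEN : ∀ I' : RoutingInstance T M,
      A.pathExp I' L T N = ∑ t ∈ B, A.selectProb I' L t a := by
    intro I'
    rw [hBsum, hN, pathExp_sum]
    refine sum_congr rfl fun i _ => ?_
    have := pathExp_model A I' L T i fun m => if (i : ℕ) ∈ B then (if m = a then 1 else 0) else 0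
    rw [this]
    split_ifs <;> simp
  have hN0 : ∀ h, 0 ≤ N h := fun h => sum_nonneg fun i _ => by split_ifs <;> norm_num
  have hN1 : ∀ h, N h ≤ B.card := by
    intro h
    have : (B.card : ℝ) = ∑ t ∈ B, (1 : ℝ) := by simp
    rw [this, hBsum]
    refine sum_le_sum fun i _ => by split_ifs <;> norm_num
  have hlog : A.pathExp I L T (fun h => -Real.log (w h)) ≤
      (p - q) ^ 2 / (p * (1 - p)) * n := by
    have h1 : (fun h => -Real.log (w h)) = fun h => ∑ i : Fin T,
        -Real.log (roundRatio B a q p i (h i).2.1 (h i).2.2) := by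
      funext h
      rw [hw, Real.log_prod fun i _ => (hrpos _ _ _).ne', sum_neg_distrib]
    rw [h1, pathExp_sum, hn, mul_sum, hBsum]
    refine sum_le_sum fun i _ => ?_
    rw [pathExp_model_reward A I L T i fun m r => -Real.log (roundRatio B a q p i m r)]
    split_ifs with hi
    · rw [sum_eq_single a]
      · rw [hI _ hi, mul_comm]
        refine mul_le_mul_of_nonneg_right ?_ (selectProb_nonneg A I L i.2 a)
        have := bernoulli_kl_le hq0 hq1 hp0 hp1
        simp only [roundRatio, hi, and_self, if_true]
        linarith
      · intro m _ hm
        simp [roundRatio, hm]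
      · simp
    · simp [roundRatio, hi]
  have hEw : A.pathExp I L T w = 1 := by
    have := hchange fun _ => 1
    rw [pathExp_one] at this
    simpa using this.symm
  have hpt : ∀ h, w h * N h ≤ N h +
      B.card * (8 * (-Real.log (w h)) + (8 + 1 / 16) * w h + -(8 - 1 / 16) * 1) := by
    intro h
    have h1 := abs_sub_one_le_of_pos (hwpos h)
    have h2 : (w h - 1) * N h ≤ |w h - 1| * N h :=
      mul_le_mul_of_nonneg_right (le_abs_self _) (hN0 h)
    have h3 : |w h - 1| * N h ≤ |w h - 1| * B.card :=
      mul_le_mul_of_nonneg_left (hN1 h) (abs_nonneg _)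
    have h4 := mul_le_mul_of_nonneg_left h1 (Nat.cast_nonneg (α := ℝ) B.card)
    linarith
  rw [← hEN J, hchange]
  refine (pathExp_mono A I L le_rfl hpt).trans ?_
  rw [pathExp_add, pathExp_const_mul, pathExp_add, pathExp_add, pathExp_const_mul,
    pathExp_const_mul, pathExp_const_mul, pathExp_one, hEw, hEN I]
  refine add_le_add_right (mul_le_mul_of_nonneg_left ?_ (Nat.cast_nonneg _)) _
  linarith

end ChangeOfMeasure

end LLMRouting

namespace LLMRouting

open Finset

/-- The instance with given means in which all models are always available, with unit cost and
throughput limit one. -/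
def unitInstance {T M : ℕ} (μ : ℕ → Fin M → ℝ) (hμ : ∀ t < T, ∀ m, μ t m ∈ Set.Icc (0 : ℝ) 1) :
    RoutingInstance T M where
  mean := μ
  mean_mem := hμ
  cost _ := 1
  cost_pos _ := one_pos
  throughput _ := 1
  avail _ := 0

/-- The means of the drifting instance with batch length `Δ`, gap `ε` and strong models `s`. -/
noncomputable def driftMean {M : ℕ} (Δ : ℕ) (ε : ℝ) (s : ℕ → Fin M) (t : ℕ) (m : Fin M) : ℝ :=
  1 / 2 + ((t / Δ : ℕ) : ℝ) * ε + if m = s (t / Δ) then ε else 0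

/-- The rounds of batch `j`. -/
def batch (T Δ j : ℕ) : Finset ℕ := (range T).filter fun t => t / Δ = j

lemma card_batch_le {T Δ : ℕ} (hΔ : 0 < Δ) (j : ℕ) : (batch T Δ j).card ≤ Δ := by
  have : batch T Δ j ⊆ Ico (j * Δ) (j * Δ + Δ) := by
    intro t ht
    obtain ⟨-, rfl⟩ := mem_filter.1 ht
    have h1 := Nat.div_add_mod t Δ
    have h2 := Nat.mod_lt t hΔ
    rw [mul_comm] at h1
    exact mem_Ico.2 ⟨by omega, by omega⟩
  simpa using card_le_card this

lemma sum_batch {T Δ : ℕ} (f : ℕ → ℝ) :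
    ∑ j ∈ range T, ∑ t ∈ batch T Δ j, f t = ∑ t ∈ range T, f t :=
  sum_fiberwise_of_maps_to
    (fun t ht => mem_range.2 ((Nat.div_le_self t Δ).trans_lt (mem_range.1 ht))) f

/-- The means of the drifting instance, without a strong model in batch `j`. -/
noncomputable def levelMean {M : ℕ} (T Δ : ℕ) (ε : ℝ) (s : ℕ → Fin M) (j t : ℕ) (m : Fin M) : ℝ :=
  if t ∈ batch T Δ j then 1 / 2 + (j : ℝ) * ε else driftMean Δ ε s t m

section Drift

variable {T M Mmax : ℕ} {Δ : ℕ} {ε : ℝ}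

lemma batch_index_bound (hε : 0 ≤ ε) (h : (⌈(T : ℝ) / (Δ : ℝ)⌉₊ : ℝ) * ε ≤ 1 / 4) (hΔ : 0 < Δ)
    {t : ℕ} (ht : t < T) : (((t / Δ : ℕ) : ℝ) + 1) * ε ≤ 1 / 4 := by
  refine le_trans (mul_le_mul_of_nonneg_right ?_ hε) h
  have h1 : t / Δ < ⌈(T : ℝ) / (Δ : ℝ)⌉₊ := by
    rw [Nat.lt_ceil]
    refine lt_of_le_of_lt Nat.cast_div_le ?_
    gcongr
  exact_mod_cast h1

lemma driftMean_mem (hε : 0 ≤ ε) (h : (⌈(T : ℝ) / (Δ : ℝ)⌉₊ : ℝ) * ε ≤ 1 / 4) (hΔ : 0 < Δ)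
    (s : ℕ → Fin M) (t : ℕ) (ht : t < T) (m : Fin M) :
    driftMean Δ ε s t m ∈ Set.Icc (0 : ℝ) 1 := by
  have h1 := batch_index_bound hε h hΔ ht
  have h2 : 0 ≤ ((t / Δ : ℕ) : ℝ) * ε := by positivity
  unfold driftMean
  constructor <;> split_ifs <;> linarith

lemma levelMean_mem (hε : 0 ≤ ε) (h : (⌈(T : ℝ) / (Δ : ℝ)⌉₊ : ℝ) * ε ≤ 1 / 4) (hΔ : 0 < Δ)
    (s : ℕ → Fin M) (j t : ℕ) (ht : t < T) (m : Fin M) :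
    levelMean T Δ ε s j t m ∈ Set.Icc (0 : ℝ) 1 := by
  unfold levelMean
  split_ifs with hj
  · obtain ⟨-, rfl⟩ := mem_filter.1 hj
    have h1 := batch_index_bound hε h hΔ ht
    have h2 : 0 ≤ ((t / Δ : ℕ) : ℝ) * ε := by positivity
    constructor <;> linarith
  · exact driftMean_mem hε h hΔ s t ht m

lemma isDriftingBatch_unitInstance (s : ℕ → Fin M)
    (hμ : ∀ t < T, ∀ m, driftMean Δ ε s t m ∈ Set.Icc (0 : ℝ) 1) :
    (unitInstance _ hμ).IsDriftingBatch Δ ε s where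
  strong t _ := by simp only [unitInstance, driftMean, if_true]; ring
  weak t _ m hm := by simp [unitInstance, driftMean, hm]
  cost_eq _ := rfl
  throughput_eq _ := rfl
  avail_eq _ := rfl

/-- In one batch, some model can be made the strong one without being selected in more than three
quarters of the rounds. -/
lemma exists_strong_model (A : Policy M Mmax) (L : ℕ) (hM : 2 ≤ M) (hε : 0 ≤ ε)
    (h : (⌈(T : ℝ) / (Δ : ℝ)⌉₊ : ℝ) * ε ≤ 1 / 4) (hΔ : 0 < Δ)
    (hεΔ : 384 * (ε ^ 2 * Δ) ≤ M) (s : ℕ → Fin M) (j : ℕ) :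
    ∃ a : Fin M, ∑ t ∈ batch T Δ j,
        A.selectProb (unitInstance _ (driftMean_mem hε h hΔ (Function.update s j a))) L t a ≤
      3 / 4 * (batch T Δ j).card := by
  have hM0 : (0 : ℝ) < M := by positivity
  have hM2 : (2 : ℝ) ≤ M := by exact_mod_cast hM
  have : Nonempty (Fin M) := ⟨⟨0, by omega⟩⟩
  set B := batch T Δ j with hB
  set I₀ := unitInstance _ (levelMean_mem (M := M) hε h hΔ s j) with hI₀
  obtain hB0 | ⟨t₀, ht₀⟩ := B.eq_empty_or_nonempty
  · exact ⟨Classical.arbitrary _, by simp [hB0]⟩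
  have hjε : ((j : ℝ) + 1) * ε ≤ 1 / 4 := by
    obtain ⟨ht, rfl⟩ := mem_filter.1 ht₀
    exact batch_index_bound hε h hΔ (mem_range.1 ht)
  have hjε0 : 0 ≤ (j : ℝ) * ε := by positivity
  obtain ⟨a, -, ha⟩ : ∃ a ∈ (univ : Finset (Fin M)),
      ∑ t ∈ B, A.selectProb I₀ L t a ≤ (B.card : ℝ) / M := by
    refine exists_le_of_sum_le univ_nonempty ?_
    rw [sum_comm]
    simp only [sum_selectProb, sum_const, card_univ, Fintype.card_fin, nsmul_eq_mul]
    rw [mul_div_cancel₀ _ hM0.ne', mul_one]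
  refine ⟨a, ?_⟩
  set J := unitInstance _ (driftMean_mem (T := T) hε h hΔ (Function.update s j a)) with hJ
  have hp0 : 0 < 1 / 2 + ((j : ℝ) + 1) * ε := by linarith
  have hmain := sum_selectProb_le A L (I := I₀) (J := J) (B := B) (a := a)
    (q := 1 / 2 + (j : ℝ) * ε) (p := 1 / 2 + ((j : ℝ) + 1) * ε) (filter_subset _ _)
    (by linarith) (by linarith) hp0 (by linarith)
    (fun t ht => by simp only [hI₀, unitInstance, levelMean, ← hB, ht, if_true])
    (fun t ht => by
      obtain ⟨-, rfl⟩ := mem_filter.1 ht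
      simp only [hJ, unitInstance, driftMean, Function.update_self, if_true]
      ring)
    (fun t htT m htm => by
      simp only [hI₀, hJ, unitInstance, levelMean, ← hB]
      by_cases ht : t ∈ B
      · have hm : m ≠ a := fun hm => htm ⟨ht, hm⟩
        obtain ⟨-, rfl⟩ := mem_filter.1 ht
        simp [driftMean, hm, ht]
      · rw [if_neg ht]
        unfold driftMean
        have htj : t / Δ ≠ j := fun htj => ht (mem_filter.2 ⟨mem_range.2 htT, htj⟩)
        rw [Function.update_of_ne htj])
  set n := ∑ t ∈ B, A.selectProb I₀ L t a with hn
  have hn0 : 0 ≤ n := sum_nonneg fun t ht =>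
    selectProb_nonneg A I₀ L (mem_range.1 (mem_filter.1 ht).1) a
  have hcard : (B.card : ℝ) ≤ Δ := by exact_mod_cast card_batch_le hΔ j
  have hchi : (1 / 2 + ((j : ℝ) + 1) * ε - (1 / 2 + (j : ℝ) * ε)) ^ 2 /
      ((1 / 2 + ((j : ℝ) + 1) * ε) * (1 - (1 / 2 + ((j : ℝ) + 1) * ε))) ≤ 6 * ε ^ 2 := by
    rw [div_le_iff₀ (mul_pos hp0 (by linarith))]
    have : 1 / 6 ≤ (1 / 2 + ((j : ℝ) + 1) * ε) * (1 - (1 / 2 + ((j : ℝ) + 1) * ε)) := by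
      nlinarith
    nlinarith [sq_nonneg ε]
  have hn1 : n ≤ 1 / 2 * B.card := by
    refine ha.trans ?_
    rw [div_le_iff₀ hM0]
    nlinarith [Nat.cast_nonneg (α := ℝ) B.card]
  have hn2 : 384 * (ε ^ 2 * n) ≤ 1 := by
    have h1 : n * M ≤ Δ := ((le_div_iff₀ hM0).1 ha).trans hcard
    have h2 : (384 * (ε ^ 2 * n)) * M ≤ 1 * M := by nlinarith [sq_nonneg ε]
    exact le_of_mul_le_mul_right h2 hM0
  have h3 := mul_le_mul_of_nonneg_right hchi hn0
  have h4 : (B.card : ℝ) * (8 * ((1 / 2 + ((j : ℝ) + 1) * ε - (1 / 2 + (j : ℝ) * ε)) ^ 2 /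
      ((1 / 2 + ((j : ℝ) + 1) * ε) * (1 - (1 / 2 + ((j : ℝ) + 1) * ε))) * n) + 1 / 8) ≤
      B.card * (1 / 4) :=
    mul_le_mul_of_nonneg_left (by linarith) (Nat.cast_nonneg _)
  linarith

/-- The strong models can be chosen batch by batch, since the policy does not see the future. -/
lemma exists_strong_models (A : Policy M Mmax) (L : ℕ) (hM : 2 ≤ M) (hε : 0 ≤ ε)
    (h : (⌈(T : ℝ) / (Δ : ℝ)⌉₊ : ℝ) * ε ≤ 1 / 4) (hΔ : 0 < Δ)
    (hεΔ : 384 * (ε ^ 2 * Δ) ≤ M) (n : ℕ) :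
    ∃ s : ℕ → Fin M, ∀ j < n, ∑ t ∈ batch T Δ j,
        A.selectProb (unitInstance _ (driftMean_mem hε h hΔ s)) L t (s j) ≤
      3 / 4 * (batch T Δ j).card := by
  induction n with
  | zero => exact ⟨fun _ => ⟨0, by omega⟩, by simp⟩
  | succ n ih =>
    obtain ⟨s, hs⟩ := ih
    obtain ⟨a, ha⟩ := exists_strong_model A L hM hε h hΔ hεΔ s n
    refine ⟨Function.update s n a, fun j hj => ?_⟩
    obtain rfl | hjn := eq_or_ne j n
    · simpa using ha
    · rw [Function.update_of_ne hjn]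
      refine le_trans (le_of_eq (sum_congr rfl fun t ht => ?_)) (hs j (by omega))
      refine selectProb_congr A L t (fun i hi => ?_) _
      obtain ⟨-, rfl⟩ := mem_filter.1 ht
      have : i / Δ ≤ t / Δ := Nat.div_le_div_right hi
      funext m
      simp only [unitInstance, driftMean]
      rw [Function.update_of_ne (by omega)]

lemma le_rate {I : RoutingInstance T M} {s : ℕ → Fin M} (hI : I.IsDriftingBatch Δ ε s) {b : ℝ}
    (hb : 1 ≤ b) (hMmax : 0 < Mmax) {t : ℕ} (ht : t < T) :
    1 / 2 + (((t / Δ : ℕ) : ℝ) + 1) * ε ≤ I.rate t b Mmax (I.pool t) := by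
  refine le_csSup ⟨1, ?_⟩ ⟨Pi.single (s (t / Δ)) 1, fun m => ?_, fun m hm => ?_, ?_, ?_,
    fun m _ => ?_, ?_, ?_⟩
  · rintro v ⟨p, hp0, -, hp1, -, -, -, rfl⟩
    rw [← hp1]
    exact sum_le_sum fun m _ => mul_le_of_le_one_left (hp0 m) (I.mean_mem t ht m).2
  · rw [Pi.single_apply]; positivity
  · simp [RoutingInstance.pool, hI.avail_eq] at hm
  · simp
  · simpa [hI.cost_eq] using hb
  · rw [hI.throughput_eq, Pi.single_apply]; split_ifs <;> norm_num
  · simpa [Pi.single_apply, filter_eq'] using Nat.succ_le_of_lt hMmax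
  · simp [Pi.single_apply, hI.strong t ht]

lemma performance_of_isDriftingBatch (A : Policy M Mmax) {I : RoutingInstance T M}
    {s : ℕ → Fin M} (hI : I.IsDriftingBatch Δ ε s) (K : ℕ) :
    A.performance I K = ∑ t ∈ range T, (1 / 2 + ((t / Δ : ℕ) : ℝ) * ε +
      ε * A.selectProb I (T / K) t (s (t / Δ))) := by
  rw [performance_eq]
  refine sum_congr rfl fun t ht => ?_
  have hmean : ∀ m, I.mean t m =
      1 / 2 + ((t / Δ : ℕ) : ℝ) * ε + if m = s (t / Δ) then ε else 0 := by
    intro m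
    split_ifs with hm
    · rw [hm, hI.strong t (mem_range.1 ht)]; ring
    · rw [hI.weak t (mem_range.1 ht) m hm, add_zero]
  simp only [hmean, mul_add, sum_add_distrib, ← sum_mul, sum_selectProb]
  simp [mul_comm]

lemma sum_range_mul_div (K L : ℕ) (hL : 0 < L) (f : ℕ → ℝ) :
    ∑ t ∈ range (K * L), f (t / L) = ∑ k ∈ range K, (L : ℝ) * f k := by
  induction K with
  | zero => simp
  | succ K ih =>
    rw [Nat.succ_mul, sum_range_add, ih, sum_range_succ]
    congr 1
    rw [← nsmul_eq_mul, ← card_range L, ← sum_const, card_range]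
    refine sum_congr rfl fun i hi => ?_
    rw [mul_comm K L, Nat.mul_add_div hL, Nat.div_eq_of_lt (mem_range.1 hi), add_zero]

/-- The stage-start benchmark of a drifting instance, if every stage lies in one batch. -/
lemma le_stage_benchmark {I : RoutingInstance T M} {s : ℕ → Fin M}
    (hI : I.IsDriftingBatch Δ ε s) {b : ℝ} (hb : 1 ≤ b) (hMmax : 0 < Mmax) {K : ℕ} (hK : K ∣ T)
    (hT : 0 < T) (hΔ : T / K ∣ Δ) :
    ∑ t ∈ range T, (1 / 2 + (((t / Δ : ℕ) : ℝ) + 1) * ε) ≤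
      ∑ k ∈ range K, ((T / K : ℕ) : ℝ) * I.rate (k * (T / K)) b Mmax (I.pool (k * (T / K))) := by
  obtain ⟨L, rfl⟩ := hK
  obtain ⟨hK0, hL0⟩ : 0 < K ∧ 0 < L := by
    constructor <;> refine Nat.pos_of_ne_zero ?_ <;> rintro rfl <;> simp at hT
  rw [Nat.mul_div_cancel_left L hK0] at hΔ ⊢
  obtain ⟨d, rfl⟩ := hΔ
  simp only [← Nat.div_div_eq_div_mul]
  rw [sum_range_mul_div K L hL0 fun k => 1 / 2 + (((k / d : ℕ) : ℝ) + 1) * ε]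
  refine sum_le_sum fun k hk => mul_le_mul_of_nonneg_left ?_ (Nat.cast_nonneg _)
  have := le_rate hI hb hMmax (t := k * L)
    (Nat.mul_lt_mul_of_pos_right (mem_range.1 hk) hL0)
  rwa [← Nat.div_div_eq_div_mul, Nat.mul_div_cancel k hL0] at this

/-- The lower bound for a drifting instance with admissible batch length and gap. -/
lemma exists_hard_instance (A : Policy M Mmax) {K : ℕ} (hM : 2 ≤ M) (hT : 0 < T) (hK : K ∣ T)
    (hε : 0 ≤ ε) (h : (⌈(T : ℝ) / (Δ : ℝ)⌉₊ : ℝ) * ε ≤ 1 / 4) (hΔ : 0 < Δ)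
    (hεΔ : 384 * (ε ^ 2 * Δ) ≤ M) {b : ℝ} (hb : 1 ≤ b) (hMmax : 0 < Mmax) :
    ∃ (s : ℕ → Fin M) (I : RoutingInstance T M), I.IsDriftingBatch Δ ε s ∧
      ε * T / 4 ≤ A.regret I K b ∧ (T / K ∣ Δ → ε * T / 4 ≤ A.stageRegret I K b) := by
  obtain ⟨s, hs⟩ := exists_strong_models A (T / K) hM hε h hΔ hεΔ T
  set I := unitInstance _ (driftMean_mem hε h hΔ s)
  have hI : I.IsDriftingBatch Δ ε s := isDriftingBatch_unitInstance s _
  have hsel : ∑ t ∈ range T, A.selectProb I (T / K) t (s (t / Δ)) ≤ 3 / 4 * T := by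
    have hT' : (T : ℝ) = ∑ t ∈ range T, (1 : ℝ) := by simp
    rw [hT', ← sum_batch (Δ := Δ) fun _ => 1,
      ← sum_batch (Δ := Δ) fun t => A.selectProb I (T / K) t (s (t / Δ)), mul_sum]
    refine sum_le_sum fun j hj => ?_
    refine le_trans (le_of_eq (sum_congr rfl fun t ht => ?_))
      ((hs j (mem_range.1 hj)).trans (by simp))
    rw [(mem_filter.1 ht).2]
  have hbench : ε * T / 4 + A.performance I K ≤
      ∑ t ∈ range T, (1 / 2 + (((t / Δ : ℕ) : ℝ) + 1) * ε) := by
    have h1 : ∑ t ∈ range T, (1 / 2 + (((t / Δ : ℕ) : ℝ) + 1) * ε) =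
        ∑ t ∈ range T, (1 / 2 + ((t / Δ : ℕ) : ℝ) * ε) + T * ε := by
      rw [← nsmul_eq_mul, ← card_range T, ← sum_const, card_range, ← sum_add_distrib]
      exact sum_congr rfl fun t _ => by ring
    rw [performance_of_isDriftingBatch A hI, h1, sum_add_distrib, ← mul_sum]
    nlinarith
  refine ⟨s, I, hI, ?_, fun hdvd => ?_⟩
  · have : ∑ t ∈ range T, (1 / 2 + (((t / Δ : ℕ) : ℝ) + 1) * ε) ≤
        ∑ t ∈ range T, I.rate t b Mmax (I.pool t) :=
      sum_le_sum fun t ht => le_rate hI hb hMmax (mem_range.1 ht)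
    unfold Policy.regret
    linarith
  · have := le_stage_benchmark hI hb hMmax hK hT hdvd
    unfold Policy.stageRegret
    linarith

end Drift

/-- A batch length of the order of `X`, which is a multiple of the given divisor of the horizon. -/
lemma exists_batch_length {T L : ℕ} (hL : L ∣ T) (hT : 0 < T) {X : ℝ} (hX : 0 < X) (hXT : X ≤ T)
    (hLX : (L : ℝ) ≤ 2 * X) :
    ∃ Δ : ℕ, 0 < Δ ∧ Δ ≤ T ∧ L ∣ Δ ∧ X ≤ Δ ∧ (Δ : ℝ) ≤ 3 * X := by
  obtain ⟨K, rfl⟩ := hL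
  have hL0 : 0 < L := Nat.pos_of_mul_pos_right hT
  have hL0' : (0 : ℝ) < L := by exact_mod_cast hL0
  have hlow : X ≤ (L : ℝ) * ⌈X / L⌉₊ := by
    have := Nat.le_ceil (X / L)
    rwa [div_le_iff₀ hL0', mul_comm] at this
  refine ⟨L * ⌈X / L⌉₊, Nat.mul_pos hL0 (Nat.ceil_pos.2 (by positivity)), ?_, dvd_mul_right _ _,
    by exact_mod_cast hlow, ?_⟩
  · refine Nat.mul_le_mul_left L (Nat.ceil_le.2 ?_)
    rw [div_le_iff₀ hL0', mul_comm]
    exact_mod_cast hXT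
  · have h1 := (Nat.ceil_lt_add_one (div_pos hX hL0').le).le
    have h2 := mul_le_mul_of_nonneg_left h1 hL0'.le
    rw [mul_add, mul_div_cancel₀ _ hL0'.ne'] at h2
    push_cast
    linarith

end LLMRouting

open LLMRouting in
theorem theorem2 :
    ∃ c c₁ c₂ C₀ : ℝ, 0 < c ∧ 0 < c₁ ∧ 0 < c₂ ∧ 0 < C₀ ∧
      ∀ M T K : ℕ, 2 ≤ M → C₀ * (M : ℝ) ≤ (T : ℝ) → 0 < K → K ∣ T →
      ∃ (Δ : ℕ) (ε : ℝ),
        0 < Δ ∧ Δ ≤ T ∧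
        c₁ * ((M : ℝ) ^ (1 / 3 : ℝ) * (T : ℝ) ^ (2 / 3 : ℝ)) ≤ (Δ : ℝ) ∧
        (Δ : ℝ) ≤ c₂ * ((M : ℝ) ^ (1 / 3 : ℝ) * (T : ℝ) ^ (2 / 3 : ℝ)) ∧
        c₁ * ((M : ℝ) / (T : ℝ)) ^ (1 / 3 : ℝ) ≤ ε ∧
        ε ≤ c₂ * ((M : ℝ) / (T : ℝ)) ^ (1 / 3 : ℝ) ∧
        (⌈(T : ℝ) / (Δ : ℝ)⌉₊ : ℝ) * ε ≤ 1 / 4 ∧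
        ∀ (Mmax : ℕ) (b : ℝ), 0 < Mmax → 1 ≤ b →
        ∀ A : LLMRouting.Policy M Mmax,
          ∃ (s : ℕ → Fin M) (I : LLMRouting.RoutingInstance T M),
            I.IsDriftingBatch Δ ε s ∧
            c * ((M : ℝ) ^ (1 / 3 : ℝ) * (T : ℝ) ^ (2 / 3 : ℝ)) ≤ A.regret I K b ∧
            ((T : ℝ) ≤ 2 * C₀ * (M : ℝ) * (K : ℝ) ^ 3 →
              c * ((M : ℝ) ^ (1 / 3 : ℝ) * (T : ℝ) ^ (2 / 3 : ℝ)) ≤ A.stageRegret I K b) := by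
  refine ⟨1 / 256, 1 / 64, 3, 1, by norm_num, by norm_num, by norm_num, by norm_num, ?_⟩
  intro M T K hM hMT hK hKT
  rw [one_mul] at hMT
  have hM0 : (0 : ℝ) < M := by positivity
  have hT0 : (0 : ℝ) < T := hM0.trans_le hMT
  have hTpos : 0 < T := by exact_mod_cast hT0
  have hT1 : (1 : ℝ) ≤ T := by exact_mod_cast hTpos
  set x : ℝ := ((M : ℝ) / (T : ℝ)) ^ (1 / 3 : ℝ) with hx
  have hx0 : 0 < x := by positivity
  have hx3 : x ^ 3 * T = M := by
    rw [hx, ← Real.rpow_natCast, ← Real.rpow_mul (by positivity)]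
    norm_num
    field_simp
  have hX : (M : ℝ) ^ (1 / 3 : ℝ) * (T : ℝ) ^ (2 / 3 : ℝ) = x * T := by
    rw [hx, Real.div_rpow hM0.le hT0.le, div_mul_eq_mul_div, eq_div_iff (by positivity), mul_assoc,
      ← Real.rpow_add hT0]
    norm_num
  rw [hX]
  have hx1 : x ≤ 1 := Real.rpow_le_one (by positivity) ((div_le_one hT0).2 hMT) (by norm_num)
  have hXT : x * T ≤ T := mul_le_of_le_one_left hT0.le hx1
  have hcube : (x * T) ^ 3 = M * T ^ 2 := by rw [← hx3]; ring
  have hX1 : 1 ≤ x * T := by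
    by_contra! hlt
    have h1 : (x * T) ^ 3 < 1 := pow_lt_one₀ (by positivity) hlt (by norm_num)
    have h2 : (1 : ℝ) ≤ M * T ^ 2 := by
      have : (2 : ℝ) ≤ M := by exact_mod_cast hM
      nlinarith
    linarith
  have hstage : (T : ℝ) ≤ 2 * 1 * (M : ℝ) * (K : ℝ) ^ 3 → ((T / K : ℕ) : ℝ) ≤ 2 * (x * T) := by
    intro hcond
    have hK0 : (0 : ℝ) < K := by exact_mod_cast hK
    rw [Nat.cast_div hKT hK0.ne']
    refine le_of_pow_le_pow_left₀ (n := 3) (by norm_num) (by positivity) ?_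
    rw [mul_pow, hcube, div_pow, div_le_iff₀ (by positivity)]
    have h1 := mul_le_mul_of_nonneg_left hcond (sq_nonneg (T : ℝ))
    have h2 : 0 ≤ (M : ℝ) * T ^ 2 * K ^ 3 := by positivity
    linarith
  obtain ⟨Δ, hΔ0, hΔT, hdvd, hΔX, hΔ3⟩ : ∃ Δ : ℕ, 0 < Δ ∧ Δ ≤ T ∧
      ((T : ℝ) ≤ 2 * 1 * (M : ℝ) * (K : ℝ) ^ 3 → T / K ∣ Δ) ∧ x * T ≤ Δ ∧
      (Δ : ℝ) ≤ 3 * (x * T) := by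
    by_cases hcond : (T : ℝ) ≤ 2 * 1 * (M : ℝ) * (K : ℝ) ^ 3
    · obtain ⟨Δ, h1, h2, h3, h4⟩ := exists_batch_length (Nat.div_dvd_of_dvd hKT) hTpos
        (by positivity) hXT (hstage hcond)
      exact ⟨Δ, h1, h2, fun _ => h3, h4⟩
    · obtain ⟨Δ, h1, h2, -, h4⟩ := exists_batch_length (one_dvd T) hTpos
        (by positivity) hXT (by push_cast; linarith)
      exact ⟨Δ, h1, h2, fun hc => absurd hc hcond, h4⟩
  have hΔ0' : (0 : ℝ) < Δ := by exact_mod_cast hΔ0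
  have hceil : (⌈(T : ℝ) / (Δ : ℝ)⌉₊ : ℝ) * (1 / 64 * x) ≤ 1 / 4 := by
    have h1 := (Nat.ceil_lt_add_one (a := (T : ℝ) / Δ) (by positivity)).le
    have h2 : (T : ℝ) / Δ * x ≤ 1 := by
      rw [div_mul_eq_mul_div, div_le_one hΔ0']; linarith
    have h3 := mul_le_mul_of_nonneg_right h1 hx0.le
    linarith
  have hεΔ : 384 * ((1 / 64 * x) ^ 2 * Δ) ≤ (M : ℝ) := by
    have h1 := mul_le_mul_of_nonneg_left hΔ3 (sq_nonneg x)
    have h2 : x ^ 2 * (3 * (x * T)) = 3 * M := by rw [← hx3]; ring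
    linarith
  refine ⟨Δ, 1 / 64 * x, hΔ0, hΔT, by linarith, hΔ3, le_rfl, by linarith, hceil, ?_⟩
  intro Mmax b hMmax hb A
  obtain ⟨s, I, hI, hreg, hstg⟩ := exists_hard_instance A hM hTpos hKT (by positivity) hceil hΔ0
    hεΔ hb hMmax
  refine ⟨s, I, hI, ?_, fun hcond => ?_⟩
  · linarith
  · have := hstg (hdvd hcond)
    linarith
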